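/- Let $Z\subseteq\mathbb{R}^d$, let $G$ be a Borel probability measure on $Z$, and let $f:Z\times Z\to\mathbb{R}$ be bounded, symmetric, and Lipschitz in each variable (for every fixed value of one argument, $f$ is Lipschitz in the other). Let $\mathcal{A}g(x)=\int f(x,y)g(y)\,\mathrm{d}G(y)$ be the integral operator of $f$ on the real space $L^2(G)$. Then the eigenvalues of $\mathcal{A}$ can be listed as a sequence $\lambda_1,\lambda_2,\ldots$ of real numbers in which every nonzero $\mu$ occurs exactly $\dim\ker(\mathcal{A}-\mu)$ times (and $0$ may occur any number of times), and for every such sequence: 1. The series $\sum_k\lambda_k^3$ converges absolutely and $$\iiint f(x,y)f(y,z)f(z,x)\,\mathrm{d}G(x)\,\mathrm{d}G(y)\,\mathrm{d}G(z)=\sum_{k=1}^\infty\lambda_k^3 .$$ 2. If $f$ is positive-definite, i.e. $\sum_{i,j=1}^m c_ic_jf(x_i,x_j)\ge 0$ for all $m$, all $x_1,\ldots,x_m\in Z$ and all $c_1,\ldots,c_m\in\mathbb{R}$, then $\lambda_k\ge 0$ for all $k$. 3. Suppose in addition that $f$ takes values in $[0,1]$ (but need not be positive-definite). Let $X_1,\ldots,X_n$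 be i.i.d. from $G$ and consider the simple random graph on $\{1,\ldots,n\}$ in which, conditionally on $X_1,\ldots,X_n$, the pairs $i<j$ are edges independently with probabilities $f(X_i,X_j)$. Its expected number $T_n$ of triangles (unordered triples of mutually adjacent nodes) is $$T_n=\binom n3\sum_{k=1}^\infty\lambda_k^3 ,$$ so negative eigenvalues can only reduce it: for every set $S$ of indices $k$ with $\lambda_k<0$, $T_n\le\binom n3\sum_{k\notin S}\lambda_k^3$. -/

import Mathlib

open MeasureTheory
open scoped ENNReal

/-- The real kernel `f` is Lipschitz in each variable: each partial function obtained by fixing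
the other variable is Lipschitz. -/
def LipschitzInEachVariable {α : Type*} [PseudoEMetricSpace α] (f : α → α → ℝ) : Prop :=
  (∀ y, ∃ K : NNReal, LipschitzWith K (fun x => f x y)) ∧
    (∀ x, ∃ K : NNReal, LipschitzWith K (fun y => f x y))

/-- A positive-definite kernel: it is symmetric, and every finite Gram matrix
`(f (x i) (x j))` has a nonnegative quadratic form. -/
def IsPosDefKernel {α : Type*} (f : α → α → ℝ) : Prop :=
  (∀ x y, f x y = f y x) ∧
    ∀ (m : ℕ) (x : Fin m → α) (c : Fin m → ℝ),
      0 ≤ ∑ i, ∑ j, c i * c j * f (x i) (x j)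

theorem LipschitzInEachVariable.measurable {α : Type*} [MetricSpace α]
    [SecondCountableTopology α] [MeasurableSpace α] [BorelSpace α] {f : α → α → ℝ}
    (hf : LipschitzInEachVariable f) : Measurable (Function.uncurry f) := by
  refine measurable_uncurry_of_continuous_of_measurable (fun y => ?_) (fun x => ?_)
  · obtain ⟨K, hK⟩ := hf.1 y
    exact hK.continuous
  · obtain ⟨K, hK⟩ := hf.2 x
    exact hK.continuous.measurable

noncomputable section IntegralOperator

variable {α : Type*} [MeasurableSpace α]

theorem integralOperator_integrable (G : Measure α) [IsProbabilityMeasure G] {f : α → α → ℝ}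
    (hf : Measurable (Function.uncurry f)) {C : ℝ} (hC : ∀ x y, |f x y| ≤ C)
    (g : Lp ℝ 2 G) (x : α) : Integrable (fun y => f x y * g y) G :=
  ((Lp.memLp g).integrable (by norm_num)).bdd_mul
    (hf.of_uncurry_left (x := x)).aestronglyMeasurable
    (Filter.Eventually.of_forall fun y => by rw [Real.norm_eq_abs]; exact hC x y)

theorem integral_norm_le_norm_L2 (G : Measure α) [IsProbabilityMeasure G] (g : Lp ℝ 2 G) :
    ∫ y, ‖g y‖ ∂G ≤ ‖g‖ := by
  have h1 : MemLp (g : α → ℝ) 1 G := (Lp.memLp g).mono_exponent (by norm_num)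
  have h2 : ∫ y, ‖g y‖ ∂G = (eLpNorm (g : α → ℝ) 1 G).toReal := by
    rw [eLpNorm_one_eq_lintegral_enorm, integral_norm_eq_lintegral_enorm h1.1]
  rw [h2, Lp.norm_def]
  exact ENNReal.toReal_mono (Lp.eLpNorm_ne_top g)
    (eLpNorm_le_eLpNorm_of_exponent_le (by norm_num) h1.1)

theorem integralOperator_bound (G : Measure α) [IsProbabilityMeasure G] {f : α → α → ℝ}
    (hf : Measurable (Function.uncurry f)) {C : ℝ} (hC : ∀ x y, |f x y| ≤ C)
    (g : Lp ℝ 2 G) (x : α) : ‖∫ y, f x y * g y ∂G‖ ≤ C * ‖g‖ := by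
  have hC0 : 0 ≤ C := (abs_nonneg _).trans (hC x x)
  calc ‖∫ y, f x y * g y ∂G‖ ≤ ∫ y, ‖f x y * g y‖ ∂G := norm_integral_le_integral_norm _
    _ ≤ ∫ y, C * ‖g y‖ ∂G := by
        refine integral_mono (integralOperator_integrable G hf hC g x).norm
          ((((Lp.memLp g).integrable (by norm_num)).norm).const_mul C) (fun y => ?_)
        simp only [norm_mul, Real.norm_eq_abs]
        exact mul_le_mul_of_nonneg_right (hC x y) (abs_nonneg _)
    _ = C * ∫ y, ‖g y‖ ∂G := integral_const_mul _ _
    _ ≤ C * ‖g‖ := mul_le_mul_of_nonneg_left (integral_norm_le_norm_L2 G g) hC0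

theorem integralOperator_memLp (G : Measure α) [IsProbabilityMeasure G] {f : α → α → ℝ}
    (hf : Measurable (Function.uncurry f)) {C : ℝ} (hC : ∀ x y, |f x y| ≤ C)
    (g : Lp ℝ 2 G) : MemLp (fun x => ∫ y, f x y * g y ∂G) 2 G := by
  have hm : StronglyMeasurable (fun p : α × α => f p.1 p.2 * g p.2) :=
    hf.stronglyMeasurable.mul ((Lp.stronglyMeasurable g).comp_measurable measurable_snd)
  exact MemLp.of_bound hm.integral_prod_right.aestronglyMeasurable (C * ‖g‖)
    (Filter.Eventually.of_forall (integralOperator_bound G hf hC g))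

/-- The integral operator `(A g)(x) = ∫ f(x,y) g(y) dG(y)` of a bounded measurable kernel `f`, as
a bounded linear operator on the real Hilbert space `L²(G)`. -/
def integralOperator (G : Measure α) [IsProbabilityMeasure G] (f : α → α → ℝ)
    (hf : Measurable (Function.uncurry f)) (hb : ∃ C : ℝ, ∀ x y, |f x y| ≤ C) :
    Lp ℝ 2 G →L[ℝ] Lp ℝ 2 G :=
  LinearMap.mkContinuousOfExistsBound
    { toFun := fun g => (integralOperator_memLp G hf hb.choose_spec g).toLp _
      map_add' := fun g h => by
        rw [← MemLp.toLp_add]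
        refine MemLp.toLp_congr _ _ (Filter.Eventually.of_forall fun x => ?_)
        simp only [Pi.add_apply]
        rw [← integral_add (integralOperator_integrable G hf hb.choose_spec g x)
          (integralOperator_integrable G hf hb.choose_spec h x)]
        refine integral_congr_ae ?_
        filter_upwards [Lp.coeFn_add g h] with y hy
        rw [hy, Pi.add_apply, mul_add]
      map_smul' := fun c g => by
        rw [RingHom.id_apply, ← MemLp.toLp_const_smul]
        refine MemLp.toLp_congr _ _ (Filter.Eventually.of_forall fun x => ?_)
        simp only [Pi.smul_apply, smul_eq_mul]
        rw [← integral_const_mul]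
        refine integral_congr_ae ?_
        filter_upwards [Lp.coeFn_smul c g] with y hy
        rw [hy, Pi.smul_apply, smul_eq_mul]
        ring }
    (by
      refine ⟨hb.choose, fun g => ?_⟩
      obtain ⟨x0⟩ : Nonempty α := nonempty_of_isProbabilityMeasure G
      have h0 : 0 ≤ hb.choose * ‖g‖ :=
        (norm_nonneg _).trans (integralOperator_bound G hf hb.choose_spec g x0)
      have h := Lp.norm_le_of_ae_bound (p := 2) (μ := G)
        (f := (integralOperator_memLp G hf hb.choose_spec g).toLp _) h0 (by
          filter_upwards [(integralOperator_memLp G hf hb.choose_spec g).coeFn_toLp] with x hx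
          rw [hx]
          exact integralOperator_bound G hf hb.choose_spec g x)
      simpa [measureUnivNNReal] using h)

theorem integralOperator_apply (G : Measure α) [IsProbabilityMeasure G] (f : α → α → ℝ)
    (hf : Measurable (Function.uncurry f)) (hb : ∃ C : ℝ, ∀ x y, |f x y| ≤ C) (g : Lp ℝ 2 G) :
    integralOperator G f hf hb g =ᵐ[G] fun x => ∫ y, f x y * g y ∂G :=
  (integralOperator_memLp G hf hb.choose_spec g).coeFn_toLp

end IntegralOperator

/-- `lam` lists the eigenvalues of the operator `A`, repeated according to multiplicity: each
nonzero real `μ` occurs in the sequence exactly `dim ker (A - μ)` times (so not at all if it is not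
an eigenvalue). The value `0` may occur any number of times, which pads the list when
there are only finitely many nonzero eigenvalues. -/
def IsEigenvalueSequence {H : Type*} [NormedAddCommGroup H] [NormedSpace ℝ H] (A : H →L[ℝ] H)
    (lam : ℕ → ℝ) : Prop :=
  ∀ μ : ℝ, μ ≠ 0 → {k : ℕ | lam k = μ}.encard =
    Cardinal.toENat (Module.rank ℝ (Module.End.eigenspace (A : H →ₗ[ℝ] H) μ))

open Classical in
/-- The conditional probability of the simple graph `H` on `n` nodes given the latent positions
`x`: each pair `i < j` is an edge independently, with probability `f (x i) (x j)`. -/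
noncomputable def graphProb {α : Type*} {n : ℕ} (f : α → α → ℝ) (x : Fin n → α)
    (H : SimpleGraph (Fin n)) : ℝ :=
  ∏ e : Fin n × Fin n with e.1 < e.2,
    if H.Adj e.1 e.2 then f (x e.1) (x e.2) else 1 - f (x e.1) (x e.2)

/-- The expected number of triangles (3-cliques) of the random graph on `n` nodes with
i.i.d. latent positions drawn from `G` and edge probabilities `f`. -/
noncomputable def expectedTriangles {α : Type*} [MeasurableSpace α] (G : Measure α)
    (f : α → α → ℝ) (n : ℕ) : ℝ :=
  ∫ x : Fin n → α, ∑ H : SimpleGraph (Fin n), graphProb f x H * ((H.cliqueSet 3).ncard : ℝ)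
    ∂(Measure.pi fun _ => G)

/-! ### Hilbert–Schmidt operators and the spectral theorem. -/

section Hilbert

open Filter Topology Module.End

variable {H : Type*} [NormedAddCommGroup H] [InnerProductSpace ℝ H]

/-! Write `f_x = f(x, ·)`, so that `(A g)(x) = ⟨f_x, g⟩` for almost every `x`. For an orthonormal
family `b`, Bessel's inequality gives `∑ ⟨f_x, b_i⟩² ≤ ‖f_x‖² ≤ C²`, and integrating over `x` gives
`∑ ‖A b_i‖² ≤ C²`. Thus `A` is Hilbert–Schmidt, hence compact; it is self-adjoint by symmetry of
`f`, so the spectral theorem applies and the nonzero eigenvalues can be enumerated.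

The trace formula (`IsEigenvalueSequence.hasSum_pow_three`) avoids any pointwise expansion of the
kernel. The inner double integral of the triangle density is exactly `⟨f_x, A f_x⟩ = ∑ λ_k ⟨f_x,
v_k⟩²`. Since `∫ ⟨f_x, v_k⟩² dG = ‖A v_k‖² = λ_k²`, integrating term by term yields `∑ λ_k³`; the
exchange is justified by `∑ |λ_k|³ < ∞`. The Lipschitz condition serves to make `f` jointly
measurable.

Positivity comes from averaging Gram forms over i.i.d. samples
(`IsPosDefKernel.inner_integralOperator_nonneg`), and the triangle count from linearity of
expectation over triples (`expectedTriangles_eq`). -/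

theorem Orthonormal.norm_sum_inner_smul_le {ι E : Type*} [NormedAddCommGroup E] [NormedSpace ℝ E]
    {b : ι → H} (hb : Orthonormal ℝ b) (A : H →L[ℝ] E) (s : Finset ι) (x : H) :
    ‖∑ i ∈ s, inner ℝ (b i) x • A (b i)‖ ≤ √(∑ i ∈ s, ‖A (b i)‖ ^ 2) * ‖x‖ := by
  calc ‖∑ i ∈ s, inner ℝ (b i) x • A (b i)‖
      ≤ ∑ i ∈ s, ‖A (b i)‖ * ‖inner ℝ (b i) x‖ := by
        refine (norm_sum_le _ _).trans (le_of_eq (Finset.sum_congr rfl fun i _ => ?_))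
        rw [norm_smul, mul_comm]
    _ ≤ √(∑ i ∈ s, ‖A (b i)‖ ^ 2) * √(∑ i ∈ s, ‖inner ℝ (b i) x‖ ^ 2) :=
        Real.sum_mul_le_sqrt_mul_sqrt _ _ _
    _ ≤ √(∑ i ∈ s, ‖A (b i)‖ ^ 2) * ‖x‖ := by
        gcongr
        exact Real.sqrt_le_left (norm_nonneg _) |>.2 (hb.sum_inner_products_le x)

/-- A Hilbert–Schmidt operator is compact. -/
theorem HilbertBasis.isCompactOperator_of_summable {ι : Type*} [CompleteSpace H]
    (b : HilbertBasis ι ℝ H) (A : H →L[ℝ] H) (hA : Summable fun i => ‖A (b i)‖ ^ 2) :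
    IsCompactOperator A := by
  classical
  let F : Finset ι → (H →L[ℝ] H) := fun s => ∑ i ∈ s, (innerSL ℝ (b i)).smulRight (A (b i))
  have hF : ∀ s x, F s x = ∑ i ∈ s, inner ℝ (b i) x • A (b i) := fun s x => by
    simp [F]
  have hlim : ∀ x, Tendsto (fun s => F s x) atTop (𝓝 (A x)) := fun x => by
    have h := (b.hasSum_repr x).mapL A
    simp only [map_smul, b.repr_apply_apply] at h
    simp only [hF]
    exact h
  -- The finite-rank truncations converge in norm: the error is at most the root of the tail of the
  -- Hilbert–Schmidt sum. The bound is proved against `F t` for `t ⊇ s` and passed to the limit.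
  have hbound : ∀ s, ‖F s - A‖ ≤ √((∑' i, ‖A (b i)‖ ^ 2) - ∑ i ∈ s, ‖A (b i)‖ ^ 2) := by
    intro s
    refine ContinuousLinearMap.opNorm_le_bound _ (Real.sqrt_nonneg _) fun x => ?_
    have h1 : Tendsto (fun t => ‖F s x - F t x‖) atTop (𝓝 ‖(F s - A) x‖) := by
      rw [sub_apply]
      exact (tendsto_const_nhds.sub (hlim x)).norm
    refine le_of_tendsto h1 ((eventually_ge_atTop s).mono fun t hst => ?_)
    have h2 : F t x - F s x = ∑ i ∈ t \ s, inner ℝ (b i) x • A (b i) := by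
      rw [hF, hF, ← Finset.sum_sdiff hst, add_sub_cancel_right]
    rw [norm_sub_rev, h2]
    refine (b.orthonormal.norm_sum_inner_smul_le A _ x).trans ?_
    gcongr
    rw [le_sub_iff_add_le, Finset.sum_sdiff hst]
    exact hA.sum_le_tsum _ fun i _ => sq_nonneg _
  refine isCompactOperator_of_tendsto (F := F) (l := atTop) ?_ (Eventually.of_forall fun s => ?_)
  · rw [tendsto_iff_norm_sub_tendsto_zero]
    refine squeeze_zero (fun _ => norm_nonneg _) hbound ?_
    have h := (hA.hasSum.const_sub (∑' i, ‖A (b i)‖ ^ 2)).sqrt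
    simpa using h
  · refine Submodule.sum_mem (compactOperator (RingHom.id ℝ) H H) fun i _ => ?_
    have h : IsCompactOperator (innerSL ℝ (b i) : H →L[ℝ] ℝ) :=
      isCompactOperator_of_locallyCompactSpace_dom (innerSL ℝ (b i) : H →L[ℝ] ℝ)
    exact h.clm_comp ((ContinuousLinearMap.id ℝ ℝ).smulRight (A (b i)))

/-- Orthonormal eigenvectors exhausting the nonzero eigenspaces, indexed by an eigenvalue
sequence. -/
structure IsEigenvectorSequence (A : H →L[ℝ] H) (lam : ℕ → ℝ)
    (v : {k // lam k ≠ 0} → H) : Prop where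
  orthonormal : Orthonormal ℝ v
  apply_eq : ∀ k : {k // lam k ≠ 0}, A (v k) = lam k • v k
  mem_span : ∀ μ : ℝ, μ ≠ 0 → ∀ w, A w = μ • w → w ∈ Submodule.span ℝ (Set.range v)

theorem ContinuousLinearMap.finite_eigenspace_of_isCompactOperator [CompleteSpace H]
    {A : H →L[ℝ] H} (hc : IsCompactOperator A) {μ : ℝ} (hμ : μ ≠ 0) :
    FiniteDimensional ℝ (eigenspace (A : H →ₗ[ℝ] H) μ) :=
  ContinuousLinearMap.finite_dimensional_eigenspace hc μ hμ

/-- The multiplicity condition makes `{k | lam k = μ}` exactly large enough to index an orthonormal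
basis of the `μ`-eigenspace; distinct eigenspaces are orthogonal by symmetry. -/
theorem IsEigenvalueSequence.exists_isEigenvectorSequence [CompleteSpace H] {A : H →L[ℝ] H}
    (hc : IsCompactOperator A) (hs : A.IsSymmetric) {lam : ℕ → ℝ}
    (hlam : IsEigenvalueSequence A lam) : ∃ v, IsEigenvectorSequence A lam v := by
  classical
  have key : ∀ μ : ℝ, μ ≠ 0 → ∃ u : {k // lam k = μ} → H, Orthonormal ℝ u ∧
      (∀ k, A (u k) = μ • u k) ∧
      ∀ w, A w = μ • w → w ∈ Submodule.span ℝ (Set.range u) := by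
    intro μ hμ
    have := ContinuousLinearMap.finite_eigenspace_of_isCompactOperator hc hμ
    have hcard := hlam μ hμ
    rw [← Module.finrank_eq_rank, Cardinal.toENat_nat] at hcard
    have hfin : {k | lam k = μ}.Finite := Set.finite_of_encard_eq_coe hcard
    have : Fintype {k // lam k = μ} := hfin.fintype
    have hn : Fintype.card {k // lam k = μ} =
        Module.finrank ℝ (eigenspace (A : H →ₗ[ℝ] H) μ) := by
      rw [← Nat.card_eq_fintype_card, ← ENat.natCast_inj, ← hcard]
      exact (ENat.card_eq_coe_natCard {k // lam k = μ}).symm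
    let e : {k // lam k = μ} ≃ Fin (Module.finrank ℝ (eigenspace (A : H →ₗ[ℝ] H) μ)) :=
      Fintype.equivFinOfCardEq hn
    let b := (stdOrthonormalBasis ℝ (eigenspace (A : H →ₗ[ℝ] H) μ)).reindex e.symm
    refine ⟨fun k => b k, ?_, fun k => ?_, fun w hw => ?_⟩
    · exact b.orthonormal.comp_linearIsometry (Submodule.subtypeₗᵢ _)
    · exact mem_eigenspace_iff.1 (b k).2
    · have hw' : w ∈ eigenspace (A : H →ₗ[ℝ] H) μ := mem_eigenspace_iff.2 hw
      have h0 : _ = w := congrArg Subtype.val (b.sum_repr ⟨w, hw'⟩)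
      rw [Submodule.coe_sum] at h0
      rw [← h0]
      exact Submodule.sum_mem _ fun i _ => Submodule.smul_mem _ _
        (Submodule.subset_span ⟨i, rfl⟩)
  choose u hu1 hu2 hu3 using key
  refine ⟨fun k => u (lam k) k.2 ⟨k, rfl⟩, ⟨?_, ?_⟩, fun k => hu2 _ k.2 _, ?_⟩
  · exact fun k => (hu1 _ k.2).1 _
  · intro k l hkl
    by_cases h : lam k = lam l
    · obtain ⟨k, hk⟩ := k
      obtain ⟨l, hl⟩ := l
      dsimp only at h ⊢
      -- The two vectors come from differently typed families; generalising `μ` allows the equality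
      -- of eigenvalues to be substituted.
      have aux : ∀ μ (hμ : μ ≠ 0) (h' : lam k = μ), u (lam k) hk ⟨k, rfl⟩ = u μ hμ ⟨k, h'⟩ := by
        rintro μ hμ rfl; rfl
      rw [aux _ hl h]
      exact (hu1 _ hl).2 fun h' => hkl (by simpa using h')
    · exact hs.orthogonalFamily_eigenspaces h
        ⟨_, mem_eigenspace_iff.2 (hu2 _ k.2 _)⟩ ⟨_, mem_eigenspace_iff.2 (hu2 _ l.2 _)⟩
  · intro μ hμ w hw
    refine Submodule.span_mono ?_ (hu3 μ hμ w hw)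
    rintro _ ⟨⟨k, rfl⟩, rfl⟩
    exact ⟨⟨k, hμ⟩, rfl⟩

/-- Spectral decomposition of a compact self-adjoint operator. -/
theorem IsEigenvectorSequence.hasSum_apply [CompleteSpace H] {A : H →L[ℝ] H}
    (hc : IsCompactOperator A) (hs : A.IsSymmetric) {lam : ℕ → ℝ} {v : {k // lam k ≠ 0} → H}
    (hv : IsEigenvectorSequence A lam v) (g : H) :
    HasSum (fun k : {k // lam k ≠ 0} => (lam k * inner ℝ (v k) g) • v k) (A g) := by
  have hsum : Summable fun k : {k // lam k ≠ 0} => inner ℝ (v k) g • v k := by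
    have h := (hv.orthonormal.orthogonalFamily.summable_iff_norm_sq_summable
      (fun k => inner ℝ (v k) g)).2 (hv.orthonormal.inner_products_summable g)
    simpa using h
  set s := ∑' k : {k // lam k ≠ 0}, inner ℝ (v k) g • v k with hs_def
  have hperp : ∀ k : {k // lam k ≠ 0}, inner ℝ (v k) (g - s) = 0 := fun k => by
    have h := hsum.hasSum.mapL (innerSL ℝ (v k))
    simp only [innerSL_apply_apply, inner_smul_right] at h
    have h' := hasSum_single (f := fun i => inner ℝ (v i) g * inner ℝ (v k) (v i)) k
      fun i hi => by rw [hv.orthonormal.2 hi.symm, mul_zero]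
    rw [inner_sub_right, h.unique h', real_inner_self_eq_norm_sq, hv.orthonormal.1 k]
    ring
  -- `s` projects `g` onto the closed span of the `v k`. Then `A (g - s)` is orthogonal to every
  -- eigenspace, so it vanishes and `A g = A s`.
  have hmem : A (g - s) ∈ (⨆ μ, eigenspace (A : H →ₗ[ℝ] H) μ)ᗮ := by
    rw [Submodule.mem_orthogonal]
    intro w hw
    induction hw using Submodule.iSup_induction' with
    | zero => simp
    | add x y _ _ hx hy => rw [inner_add_left, hx, hy, add_zero]
    | mem μ w hw =>
      have hw' : A w = μ • w := mem_eigenspace_iff.1 hw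
      have h1 : inner ℝ w (A (g - s)) = inner ℝ (A w) (g - s) := (hs w (g - s)).symm
      rw [h1, hw', inner_smul_left]
      by_cases hμ : μ = 0
      · simp [hμ]
      · have h2 : Submodule.span ℝ (Set.range v) ≤ (ℝ ∙ (g - s))ᗮ := by
          rw [Submodule.span_le]
          rintro _ ⟨k, rfl⟩
          exact Submodule.mem_orthogonal_singleton_iff_inner_left.2 (hperp k)
        rw [Submodule.mem_orthogonal_singleton_iff_inner_left.1
          (h2 (hv.mem_span μ hμ w hw')), mul_zero]
  rw [ContinuousLinearMap.orthogonalComplement_iSup_eigenspaces_eq_bot hc hs,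
    Submodule.mem_bot, map_sub, sub_eq_zero] at hmem
  rw [hmem]
  have h := hsum.hasSum.mapL A
  simp only [map_smul, hv.apply_eq, smul_smul] at h
  simpa only [mul_comm] using h

/-- A symmetric compact operator that is Hilbert–Schmidt has an eigenvalue sequence. -/
theorem exists_isEigenvalueSequence [CompleteSpace H] {A : H →L[ℝ] H}
    (hc : IsCompactOperator A) (hs : A.IsSymmetric)
    (hHS : ∀ (ι : Type) (b : ι → H), Orthonormal ℝ b → Summable fun i => ‖A (b i)‖ ^ 2) :
    ∃ lam : ℕ → ℝ, IsEigenvalueSequence A lam := by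
  classical
  let I := Σ μ : {μ : ℝ // μ ≠ 0}, Fin (Module.finrank ℝ (eigenspace (A : H →ₗ[ℝ] H) μ))
  have hfd : ∀ μ : {μ : ℝ // μ ≠ 0}, FiniteDimensional ℝ (eigenspace (A : H →ₗ[ℝ] H) μ) :=
    fun μ => ContinuousLinearMap.finite_eigenspace_of_isCompactOperator hc μ.2
  let u : I → H := fun i => (stdOrthonormalBasis ℝ (eigenspace (A : H →ₗ[ℝ] H) i.1) i.2 : H)
  have hu : Orthonormal ℝ u :=
    (hs.orthogonalFamily_eigenspaces.comp Subtype.val_injective).orthonormal_sigma_orthonormal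
      fun μ : {μ : ℝ // μ ≠ 0} =>
        (stdOrthonormalBasis ℝ (eigenspace (A : H →ₗ[ℝ] H) μ)).orthonormal
  have hAu : ∀ i, ‖A (u i)‖ ^ 2 ≠ 0 := fun i => by
    have h : A (u i) = (i.1 : ℝ) • u i := mem_eigenspace_iff.1 (Subtype.prop _)
    rw [h, norm_smul, hu.1 i, mul_one]
    simpa using i.1.2
  -- A summable family has countable support, and here no term is zero.
  have hcount : Countable I := by
    have h := (hHS I u hu).countable_support
    rw [Function.support_eq_univ hAu] at h
    exact Set.countable_univ_iff.1 h
  have := Encodable.ofCountable I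
  -- `decode₂` accepts only the code of an index, so no index is listed twice; all other `n` receive
  -- the padding value `0`.
  refine ⟨fun n => ((Encodable.decode₂ I n).map fun i => (i.1 : ℝ)).getD 0, fun μ hμ => ?_⟩
  have hset : {n | ((Encodable.decode₂ I n).map fun i => (i.1 : ℝ)).getD 0 = μ} =
      Set.range fun j => Encodable.encode (⟨⟨μ, hμ⟩, j⟩ : I) := by
    ext n
    constructor
    · intro hn
      cases h : Encodable.decode₂ I n with
      | none => simp [h] at hn; exact absurd hn.symm hμ
      | some i =>
        obtain ⟨⟨ν, hν⟩, j⟩ := i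
        simp only [Set.mem_ofPred_eq, h, Option.map_some, Option.getD_some] at hn
        subst hn
        exact ⟨j, Encodable.mem_decode₂.1 h⟩
    · rintro ⟨j, rfl⟩
      simp [Encodable.decode₂_encode]
  have hinj : Function.Injective fun j => Encodable.encode (⟨⟨μ, hμ⟩, j⟩ : I) :=
    Encodable.encode_injective.comp sigma_mk_injective
  have := hfd ⟨μ, hμ⟩
  rw [hset, ← Module.finrank_eq_rank, Cardinal.toENat_nat, ← Set.image_univ, hinj.encard_image,
    Set.encard_univ]
  simp

/-- A nonzero member of an eigenvalue sequence is an eigenvalue. -/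
theorem IsEigenvalueSequence.exists_eigenvector {A : H →L[ℝ] H} {lam : ℕ → ℝ}
    (hlam : IsEigenvalueSequence A lam) {k : ℕ} (hk : lam k ≠ 0) :
    ∃ v, v ≠ 0 ∧ A v = lam k • v := by
  by_contra! h
  have hbot : eigenspace (A : H →ₗ[ℝ] H) (lam k) = ⊥ := by
    rw [Submodule.eq_bot_iff]
    intro v hv
    by_contra hv0
    exact h v hv0 (mem_eigenspace_iff.1 hv)
  have h1 := hlam _ hk
  rw [hbot, rank_bot, map_zero, Set.encard_eq_zero] at h1
  exact Set.eq_empty_iff_forall_notMem.1 h1 k rfl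

end Hilbert

/-! ### Spectrum and cubic trace of the integral operator. -/

section IntegralOperatorSpectrum

variable {α : Type*} [MeasurableSpace α] {G : Measure α} [IsProbabilityMeasure G]
  {f : α → α → ℝ}

theorem kernel_memLp (G : Measure α) [IsProbabilityMeasure G]
    (hf : Measurable (Function.uncurry f)) (hb : ∃ C : ℝ, ∀ x y, |f x y| ≤ C)
    (x : α) : MemLp (f x) 2 G :=
  MemLp.of_bound (hf.of_uncurry_left (x := x)).aestronglyMeasurable hb.choose
    (Filter.Eventually.of_forall fun y => hb.choose_spec x y)

/-- The section `f(x, ·)` of a bounded measurable kernel as an element of `L²(G)`. -/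
noncomputable def kernelSection (G : Measure α) [IsProbabilityMeasure G]
    (hf : Measurable (Function.uncurry f)) (hb : ∃ C : ℝ, ∀ x y, |f x y| ≤ C) (x : α) :
    Lp ℝ 2 G :=
  (kernel_memLp G hf hb x).toLp _

variable (hf : Measurable (Function.uncurry f)) (hb : ∃ C : ℝ, ∀ x y, |f x y| ≤ C)

theorem inner_kernelSection (g : Lp ℝ 2 G) (x : α) :
    inner ℝ (kernelSection G hf hb x) g = ∫ y, f x y * g y ∂G := by
  rw [L2.inner_def]
  refine integral_congr_ae ?_
  filter_upwards [(kernel_memLp G hf hb x).coeFn_toLp] with y hy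
  simp only [kernelSection, hy, RCLike.inner_apply, conj_trivial]
  ring

theorem measurable_inner_kernelSection (g : Lp ℝ 2 G) :
    StronglyMeasurable fun x => inner ℝ (kernelSection G hf hb x) g := by
  simp only [inner_kernelSection]
  have hm : StronglyMeasurable (fun p : α × α => f p.1 p.2 * g p.2) :=
    hf.stronglyMeasurable.mul ((Lp.stronglyMeasurable g).comp_measurable measurable_snd)
  exact hm.integral_prod_right

theorem integralOperator_ae_eq_inner (g : Lp ℝ 2 G) :
    integralOperator G f hf hb g =ᵐ[G] fun x => inner ℝ (kernelSection G hf hb x) g := by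
  simp only [inner_kernelSection]
  exact integralOperator_apply G f hf hb g

theorem integral_inner_kernelSection_sq (g : Lp ℝ 2 G) :
    ∫ x, inner ℝ (kernelSection G hf hb x) g ^ 2 ∂G = ‖integralOperator G f hf hb g‖ ^ 2 := by
  rw [← real_inner_self_eq_norm_sq, L2.inner_def]
  refine integral_congr_ae ?_
  filter_upwards [integralOperator_ae_eq_inner hf hb g] with x hx
  simp only [hx, RCLike.inner_apply, conj_trivial]
  ring

theorem exists_norm_kernelSection_le : ∃ C : ℝ, ∀ x, ‖kernelSection G hf hb x‖ ≤ C := by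
  refine ⟨hb.choose, fun x => ?_⟩
  have h0 : 0 ≤ hb.choose := (abs_nonneg _).trans (hb.choose_spec x x)
  have h := Lp.norm_le_of_ae_bound (p := 2) (μ := G) (f := kernelSection G hf hb x) h0 (by
    filter_upwards [(kernel_memLp G hf hb x).coeFn_toLp] with y hy
    rw [kernelSection, hy]
    exact hb.choose_spec x y)
  simpa [measureUnivNNReal] using h

theorem integrable_inner_kernelSection_sq (g : Lp ℝ 2 G) :
    Integrable (fun x => inner ℝ (kernelSection G hf hb x) g ^ 2) G := by
  obtain ⟨C, hC⟩ := exists_norm_kernelSection_le (G := G) hf hb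
  refine Integrable.of_bound
    ((measurable_inner_kernelSection hf hb g).pow 2).aestronglyMeasurable ((C * ‖g‖) ^ 2)
    (Filter.Eventually.of_forall fun x => ?_)
  rw [norm_pow]
  gcongr
  exact (norm_inner_le_norm _ _).trans (by gcongr; exact hC x)

/-- Bessel's inequality at each `f(x, ·)`, integrated over `x`, bounds every partial sum by `C ^ 2`.
-/
theorem summable_norm_integralOperator_sq {ι : Type*} {b : ι → Lp ℝ 2 G}
    (hb' : Orthonormal ℝ b) : Summable fun i => ‖integralOperator G f hf hb (b i)‖ ^ 2 := by
  obtain ⟨C, hC⟩ := exists_norm_kernelSection_le (G := G) hf hb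
  refine summable_of_sum_le (c := C ^ 2) (fun _ => sq_nonneg _) fun s => ?_
  simp only [← integral_inner_kernelSection_sq]
  rw [← integral_finsetSum _ fun i _ => integrable_inner_kernelSection_sq hf hb (b i)]
  calc _ ≤ ∫ _, C ^ 2 ∂G := by
        refine integral_mono (integrable_finsetSum _ fun i _ =>
          integrable_inner_kernelSection_sq hf hb (b i)) (integrable_const _) fun x => ?_
        have h := hb'.sum_inner_products_le (kernelSection G hf hb x) (s := s)
        simp only [Real.norm_eq_abs, sq_abs] at h
        simp only [real_inner_comm (b _)] at h ⊢
        refine h.trans ?_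
        gcongr
        exact hC x
    _ = C ^ 2 := by simp

theorem isCompactOperator_integralOperator : IsCompactOperator (integralOperator G f hf hb) := by
  obtain ⟨w, b, -⟩ := exists_hilbertBasis ℝ (Lp ℝ 2 G)
  exact b.isCompactOperator_of_summable _ (summable_norm_integralOperator_sq hf hb b.orthonormal)

theorem integrable_kernel_mul_mul (hf : Measurable (Function.uncurry f))
    (hb : ∃ C : ℝ, ∀ x y, |f x y| ≤ C) (g h : Lp ℝ 2 G) :
    Integrable (fun p : α × α => g p.1 * h p.2 * f p.1 p.2) (G.prod G) := by
  have hg : Integrable g G := (Lp.memLp g).integrable (by norm_num)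
  have hh : Integrable h G := (Lp.memLp h).integrable (by norm_num)
  exact (hg.mul_prod hh).mul_bdd hf.aestronglyMeasurable
    (Filter.Eventually.of_forall fun p => hb.choose_spec p.1 p.2)

theorem inner_integralOperator (g h : Lp ℝ 2 G) :
    inner ℝ g (integralOperator G f hf hb h) =
      ∫ p : α × α, g p.1 * h p.2 * f p.1 p.2 ∂(G.prod G) := by
  rw [integral_prod _ (integrable_kernel_mul_mul hf hb g h), L2.inner_def]
  refine integral_congr_ae ?_
  filter_upwards [integralOperator_apply G f hf hb h] with x hx
  simp only [hx, RCLike.inner_apply, conj_trivial]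
  rw [mul_comm, ← integral_const_mul]
  congr 1 with y
  ring

theorem integralOperator_isSymmetric (hsymm : ∀ x y, f x y = f y x) :
    (integralOperator G f hf hb).IsSymmetric := fun g h => by
  change inner ℝ (integralOperator G f hf hb g) h = inner ℝ g (integralOperator G f hf hb h)
  rw [real_inner_comm, inner_integralOperator, inner_integralOperator, ← integral_prod_swap]
  congr 1 with p
  simp only [Prod.fst_swap, Prod.snd_swap, hsymm p.2 p.1]
  ring

theorem integral_triangle_eq_inner (hsymm : ∀ x y, f x y = f y x) (x : α) :
    ∫ y, ∫ z, f x y * f y z * f z x ∂G ∂G =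
      inner ℝ (kernelSection G hf hb x)
        (integralOperator G f hf hb (kernelSection G hf hb x)) := by
  rw [inner_kernelSection]
  refine integral_congr_ae ?_
  filter_upwards [integralOperator_apply G f hf hb (kernelSection G hf hb x)] with y hy
  rw [hy, ← integral_const_mul]
  refine integral_congr_ae ?_
  filter_upwards [(kernel_memLp G hf hb x).coeFn_toLp] with z hz
  rw [kernelSection, hz, hsymm z x, mul_assoc]

/-- The trace of the third power of an integral operator. -/
theorem IsEigenvalueSequence.hasSum_pow_three (hsymm : ∀ x y, f x y = f y x) {lam : ℕ → ℝ}
    (hlam : IsEigenvalueSequence (integralOperator G f hf hb) lam) :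
    HasSum (fun k => lam k ^ 3) (∫ x, ∫ y, ∫ z, f x y * f y z * f z x ∂G ∂G ∂G) := by
  have hc := isCompactOperator_integralOperator (G := G) hf hb
  have hs := integralOperator_isSymmetric (G := G) hf hb hsymm
  obtain ⟨v, hv⟩ := hlam.exists_isEigenvectorSequence hc hs
  have hnorm : ∀ k : {k // lam k ≠ 0},
      ‖integralOperator G f hf hb (v k)‖ ^ 2 = lam k ^ 2 := fun k => by
    rw [hv.apply_eq, norm_smul, hv.orthonormal.1 k, mul_one, Real.norm_eq_abs, sq_abs]
  have hsq : Summable fun k : {k // lam k ≠ 0} => lam k ^ 2 := by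
    simpa only [hnorm] using summable_norm_integralOperator_sq hf hb hv.orthonormal
  let F : {k // lam k ≠ 0} → α → ℝ :=
    fun k x => lam k * inner ℝ (kernelSection G hf hb x) (v k) ^ 2
  have hF_int : ∀ k, Integrable (F k) G := fun k =>
    (integrable_inner_kernelSection_sq hf hb (v k)).const_mul _
  have hF : ∀ k, ∫ x, F k x ∂G = lam k ^ 3 := fun k => by
    rw [integral_const_mul, integral_inner_kernelSection_sq, hnorm]
    ring
  have hF_norm : ∀ k, ∫ x, ‖F k x‖ ∂G = |lam k| ^ 3 := fun k => by
    have h : ∀ x, ‖F k x‖ = |lam k| * inner ℝ (kernelSection G hf hb x) (v k) ^ 2 := fun x => by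
      rw [norm_mul, Real.norm_eq_abs, Real.norm_of_nonneg (sq_nonneg _)]
    simp only [h]
    rw [integral_const_mul, integral_inner_kernelSection_sq, hnorm, ← sq_abs]
    ring
  -- Each `|λ_k|` is at most `√(∑ λ_j²)`, so the cubes are dominated by a multiple of the squares.
  have hcube : Summable fun k : {k // lam k ≠ 0} => |lam k| ^ 3 := by
    refine summable_of_isBigO hsq (Asymptotics.isBigO_of_le' (c := √(∑' k : {k // lam k ≠ 0},
      lam k ^ 2)) _ fun k => ?_)
    rw [Real.norm_of_nonneg (by positivity), Real.norm_of_nonneg (sq_nonneg _), pow_succ', sq_abs]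
    gcongr
    refine Real.le_sqrt_of_sq_le ?_
    rw [sq_abs]
    exact hsq.le_tsum k fun _ _ => sq_nonneg _
  have hsum := hasSum_integral_of_summable_integral_norm hF_int (by simpa only [hF_norm] using hcube)
  simp only [hF] at hsum
  have hpt : ∀ x, ∑' k, F k x = ∫ y, ∫ z, f x y * f y z * f z x ∂G ∂G := fun x => by
    rw [integral_triangle_eq_inner hf hb hsymm]
    have h := (hv.hasSum_apply hc hs (kernelSection G hf hb x)).mapL
      (innerSL ℝ (kernelSection G hf hb x))
    simp only [innerSL_apply_apply, inner_smul_right] at h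
    rw [← h.tsum_eq]
    refine tsum_congr fun k => ?_
    rw [real_inner_comm (kernelSection G hf hb x)]
    simp only [F]
    ring
  simp only [hpt] at hsum
  refine (hasSum_subtype_iff_of_support_subset (s := {k | lam k ≠ 0}) fun k hk => ?_).1 hsum
  intro h0
  exact hk (by simp [h0])

end IntegralOperatorSpectrum

/-- Coordinate projections need not be embeddings, so measurability is asked of the integrand
instead. -/
theorem MeasureTheory.MeasurePreserving.integral_comp_of_aestronglyMeasurable
    {β γ E : Type*} [MeasurableSpace β] [MeasurableSpace γ] [NormedAddCommGroup E]
    [NormedSpace ℝ E] {μ : Measure β} {ν : Measure γ} {T : β → γ} (hT : MeasurePreserving T μ ν)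
    {g : γ → E} (hg : AEStronglyMeasurable g ν) : ∫ x, g (T x) ∂μ = ∫ y, g y ∂ν := by
  obtain ⟨hT, rfl⟩ := hT
  exact (integral_map hT.aemeasurable hg).symm

/-! ### Joint laws of two and three sample points. -/

section SampleLaw

open ProbabilityTheory

variable {α : Type*} [MeasurableSpace α] (G : Measure α) [IsProbabilityMeasure G]

theorem measurePreserving_eval_pair {ι : Type*} [Fintype ι] {i j : ι} (hij : i ≠ j) :
    MeasurePreserving (fun x : ι → α => (x i, x j)) (Measure.pi fun _ => G) (G.prod G) := by
  refine ⟨by fun_prop, ?_⟩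
  have h : iIndepFun (fun (i : ι) (x : ι → α) => x i) (Measure.pi fun _ => G) :=
    iIndepFun_pi (X := fun _ => id) fun _ => aemeasurable_id
  rw [(indepFun_iff_map_prod_eq_prod_map_map (measurable_pi_apply i).aemeasurable
    (measurable_pi_apply j).aemeasurable).1 (h.indepFun hij),
    (measurePreserving_eval (fun _ => G) i).map_eq,
    (measurePreserving_eval (fun _ => G) j).map_eq]

theorem measurePreserving_eval_triple {ι : Type*} [Fintype ι] {i j k : ι} (hij : i ≠ j)
    (hik : i ≠ k) (hjk : j ≠ k) :
    MeasurePreserving (fun x : ι → α => ((x i, x j), x k)) (Measure.pi fun _ => G)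
      ((G.prod G).prod G) := by
  refine ⟨by fun_prop, ?_⟩
  have h : iIndepFun (fun (i : ι) (x : ι → α) => x i) (Measure.pi fun _ => G) :=
    iIndepFun_pi (X := fun _ => id) fun _ => aemeasurable_id
  rw [(indepFun_iff_map_prod_eq_prod_map_map
    (measurePreserving_eval_pair G hij).measurable.aemeasurable
    (measurable_pi_apply k).aemeasurable).1
      (h.indepFun_prodMk measurable_pi_apply i j k hik hjk),
    (measurePreserving_eval_pair G hij).map_eq,
    (measurePreserving_eval (fun _ => G) k).map_eq]

end SampleLaw

/-! ### Positive-definite kernels. -/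

section PosDef

variable {α : Type*} [MeasurableSpace α] {G : Measure α} [IsProbabilityMeasure G]
  {f : α → α → ℝ} (hf : Measurable (Function.uncurry f)) (hb : ∃ C : ℝ, ∀ x y, |f x y| ≤ C)

/-- The integral operator of a positive-definite kernel is positive: the quadratic form is a limit
of expected Gram forms of i.i.d. samples. -/
theorem IsPosDefKernel.inner_integralOperator_nonneg (hpd : IsPosDefKernel f) (g : Lp ℝ 2 G) :
    0 ≤ inner ℝ g (integralOperator G f hf hb g) := by
  set q := inner ℝ g (integralOperator G f hf hb g) with hq
  rw [inner_integralOperator] at hq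
  set D := ∫ x, g x * g x * f x x ∂G with hD
  have hoff := integrable_kernel_mul_mul hf hb g g
  have hdiag : Integrable (fun x => g x * g x * f x x) G := by
    have h : Integrable (fun x => g x * g x) G := (Lp.memLp g).integrable_mul (Lp.memLp g)
    refine h.mul_bdd (c := hb.choose) ?_
      (Filter.Eventually.of_forall fun x => hb.choose_spec x x)
    exact (hf.comp (measurable_id.prodMk measurable_id)).aestronglyMeasurable
  -- With `m + 1` points the expected Gram form is `(m + 1) * (m * q + D)`: the diagonal contributes
  -- `D` per point, each ordered pair of distinct points `q`. Letting `m` grow forces `q ≥ 0`.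
  have key : ∀ m : ℕ, 0 ≤ (m : ℝ) * q + D := by
    intro m
    let P : Measure (Fin (m + 1) → α) := Measure.pi fun _ => G
    have hterm : ∀ i j : Fin (m + 1),
        Integrable (fun x : Fin (m + 1) → α => g (x i) * g (x j) * f (x i) (x j)) P ∧
        ∫ x, g (x i) * g (x j) * f (x i) (x j) ∂P = if i = j then D else q := by
      intro i j
      split_ifs with hij
      · subst hij
        have hp := measurePreserving_eval (fun _ : Fin (m + 1) => G) i
        refine ⟨hp.integrable_comp_of_integrable hdiag, ?_⟩
        exact hp.integral_comp_of_aestronglyMeasurable hdiag.1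
      · have hp := measurePreserving_eval_pair G hij
        refine ⟨hp.integrable_comp_of_integrable hoff, ?_⟩
        rw [hq]
        exact hp.integral_comp_of_aestronglyMeasurable hoff.1
    have h0 : 0 ≤ ∫ x, ∑ i, ∑ j, g (x i) * g (x j) * f (x i) (x j) ∂P :=
      integral_nonneg fun x => hpd.2 _ x fun i => g (x i)
    rw [integral_finsetSum _ fun i _ => integrable_finsetSum _ fun j _ => (hterm i j).1] at h0
    simp only [integral_finsetSum _ fun j _ => (hterm _ j).1, (hterm _ _).2] at h0
    have h1 : ∀ i : Fin (m + 1), ∑ j, (if i = j then D else q) = m * q + D := fun i => by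
      rw [← Finset.add_sum_erase _ _ (Finset.mem_univ i), if_pos rfl,
        Finset.sum_congr rfl fun j hj => if_neg (Finset.ne_of_mem_erase hj).symm]
      simp [add_comm]
    simp only [h1, Finset.sum_const, Finset.card_univ, Fintype.card_fin, nsmul_eq_mul] at h0
    exact nonneg_of_mul_nonneg_right h0 (by positivity)
  by_contra! hneg
  obtain ⟨m, hm⟩ := exists_nat_gt (D / -q)
  rw [div_lt_iff₀ (by linarith)] at hm
  linarith [key m]

theorem IsPosDefKernel.eigenvalue_nonneg (hpd : IsPosDefKernel f) {lam : ℕ → ℝ}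
    (hlam : IsEigenvalueSequence (integralOperator G f hf hb) lam) (k : ℕ) : 0 ≤ lam k := by
  by_cases hk : lam k = 0
  · exact hk.ge
  obtain ⟨v, hv0, hv⟩ := hlam.exists_eigenvector hk
  have h := hpd.inner_integralOperator_nonneg hf hb v
  rw [hv, inner_smul_right, real_inner_self_eq_norm_sq] at h
  exact nonneg_of_mul_nonneg_left h (by positivity)

end PosDef

/-! ### Expected triangle counts. -/

section Triangles

open Classical in
/-- The probability that a prescribed set `T` of pairs consists of edges, when the pairs `i < j`
are edges independently with probabilities `p`. -/
theorem sum_simpleGraph_prod_mul_ite {n : ℕ} (p : Fin n × Fin n → ℝ)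
    {T : Finset (Fin n × Fin n)} (hT : ∀ e ∈ T, e.1 < e.2) :
    ∑ H : SimpleGraph (Fin n), (∏ e : Fin n × Fin n with e.1 < e.2,
      if H.Adj e.1 e.2 then p e else 1 - p e) * (if ∀ e ∈ T, H.Adj e.1 e.2 then 1 else 0) =
    ∏ e ∈ T, p e := by
  set E : Finset (Fin n × Fin n) := Finset.univ.filter fun e => e.1 < e.2 with hE
  -- Setting the non-edge weight to `0` on `T` kills the graphs that miss a pair of `T`. Expanding
  -- `∏ (p e + q e)` over subsets of `E`, that is over graphs, then gives the sum.
  let q : Fin n × Fin n → ℝ := fun e => if e ∈ T then 0 else 1 - p e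
  have hTE : T ⊆ E := fun e he => by simp [hE, hT e he]
  have hprod : ∏ e ∈ E, (p e + q e) = ∏ e ∈ T, p e := by
    rw [← Finset.prod_subset hTE (f := fun e => p e + q e) fun e _ he => by simp [q, he]]
    exact Finset.prod_congr rfl fun e he => by simp [q, he]
  rw [← hprod, Finset.prod_add]
  refine Finset.sum_bij' (fun H _ => E.filter fun e => H.Adj e.1 e.2)
    (fun t _ => SimpleGraph.fromRel fun a b => (a, b) ∈ t) (fun H _ => by simp) (fun _ _ => by simp)
    (fun H _ => ?_) (fun t ht => ?_) (fun H _ => ?_)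
  · ext a b
    simp only [SimpleGraph.fromRel_adj, Finset.mem_filter, hE, Finset.mem_univ, true_and]
    constructor
    · rintro ⟨-, h | h⟩
      exacts [h.2, h.2.symm]
    · exact fun h => ⟨h.ne, (lt_or_gt_of_ne h.ne).imp (fun h' => ⟨h', h⟩) fun h' => ⟨h', h.symm⟩⟩
  · have ht' : ∀ e ∈ t, e.1 < e.2 := fun e he => by simpa [hE] using Finset.mem_powerset.1 ht he
    ext ⟨a, b⟩
    simp only [SimpleGraph.fromRel_adj, Finset.mem_filter, hE, Finset.mem_univ, true_and]
    constructor
    · rintro ⟨hab, -, h | h⟩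
      exacts [h, absurd hab (ht' _ h).not_gt]
    · exact fun h => ⟨ht' _ h, (ht' _ h).ne, Or.inl h⟩
  · rw [← Finset.filter_not, ← Finset.prod_ite]
    split_ifs with h
    · rw [mul_one]
      refine Finset.prod_congr rfl fun e _ => ?_
      split_ifs with he
      · rfl
      · have : e ∉ T := fun h' => he (h e h')
        simp [q, this]
    · push Not at h
      obtain ⟨e, he, hadj⟩ := h
      rw [mul_zero, Finset.prod_eq_zero (hTE he)]
      simp [hadj, q, he]

open Classical in
theorem SimpleGraph.ncard_cliqueSet_eq_sum {V : Type*} [Fintype V] (H : SimpleGraph V) (k : ℕ) :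
    ((H.cliqueSet k).ncard : ℝ) =
      ∑ s ∈ (Finset.univ : Finset V).powersetCard k, if H.IsNClique k s then 1 else 0 := by
  rw [Finset.sum_boole, ← Set.ncard_coe_finset]
  congr 2
  ext s
  simp only [SimpleGraph.mem_cliqueSet_iff, Finset.coe_filter, Finset.mem_powersetCard,
    Finset.subset_univ, true_and, Set.mem_ofPred_eq]
  exact ⟨fun h => ⟨h.card_eq, h⟩, fun h => h.2⟩

theorem Finset.exists_lt_lt_of_card_eq_three {V : Type*} [LinearOrder V] {s : Finset V}
    (hs : s.card = 3) : ∃ a b c, a < b ∧ b < c ∧ s = {a, b, c} := by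
  let e := s.orderEmbOfFin hs
  refine ⟨e 0, e 1, e 2, e.lt_iff_lt.2 (by decide), e.lt_iff_lt.2 (by decide), ?_⟩
  ext x
  rw [← Finset.mem_coe, ← s.range_orderEmbOfFin hs]
  simp only [Finset.mem_insert, Finset.mem_singleton]
  constructor
  · rintro ⟨i, rfl⟩
    fin_cases i
    exacts [Or.inl rfl, Or.inr (Or.inl rfl), Or.inr (Or.inr rfl)]
  · rintro (h | h | h) <;> exact ⟨_, h.symm⟩

open Classical in
theorem sum_graphProb_mul_isNClique {α : Type*} {n : ℕ} (f : α → α → ℝ) (x : Fin n → α)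
    {a b c : Fin n} (hab : a < b) (hbc : b < c) :
    ∑ H : SimpleGraph (Fin n), graphProb f x H * (if H.IsNClique 3 {a, b, c} then 1 else 0) =
      f (x a) (x b) * f (x b) (x c) * f (x a) (x c) := by
  have h := sum_simpleGraph_prod_mul_ite (fun e : Fin n × Fin n => f (x e.1) (x e.2))
    (T := {(a, b), (b, c), (a, c)}) (by simp [hab, hbc, hab.trans hbc])
  rw [Finset.prod_insert (by simp [hab.ne, hbc.ne]),
    Finset.prod_insert (by simp [hab.ne']), Finset.prod_singleton, ← mul_assoc] at h
  rw [← h]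
  refine Finset.sum_congr rfl fun H _ => ?_
  rw [graphProb]
  congr 1
  refine if_congr ?_ rfl rfl
  rw [SimpleGraph.is3Clique_triple_iff]
  simp only [Finset.mem_insert, Finset.mem_singleton, forall_eq_or_imp, forall_eq]
  tauto

variable {α : Type*} [MeasurableSpace α] {G : Measure α} [IsProbabilityMeasure G]
  {f : α → α → ℝ}

theorem integrable_triangle (hf : Measurable (Function.uncurry f))
    (hb : ∃ C : ℝ, ∀ x y, |f x y| ≤ C) :
    Integrable (fun p : (α × α) × α => f p.1.1 p.1.2 * f p.1.2 p.2 * f p.1.1 p.2)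
      ((G.prod G).prod G) := by
  obtain ⟨C, hC⟩ := hb
  have h1 : Measurable fun p : (α × α) × α => f p.1.1 p.1.2 :=
    hf.comp (measurable_fst.fst.prodMk measurable_fst.snd)
  have h2 : Measurable fun p : (α × α) × α => f p.1.2 p.2 :=
    hf.comp (measurable_fst.snd.prodMk measurable_snd)
  have h3 : Measurable fun p : (α × α) × α => f p.1.1 p.2 :=
    hf.comp (measurable_fst.fst.prodMk measurable_snd)
  refine Integrable.of_bound ((h1.mul h2).mul h3).aestronglyMeasurable (C * C * C)
    (Filter.Eventually.of_forall fun p => ?_)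
  have hC0 : 0 ≤ C := (abs_nonneg _).trans (hC p.2 p.2)
  rw [norm_mul, norm_mul]
  gcongr <;> exact hC _ _

theorem integral_triangle (hf : Measurable (Function.uncurry f))
    (hb : ∃ C : ℝ, ∀ x y, |f x y| ≤ C) (hsymm : ∀ x y, f x y = f y x) :
    ∫ p : (α × α) × α, f p.1.1 p.1.2 * f p.1.2 p.2 * f p.1.1 p.2 ∂((G.prod G).prod G) =
      ∫ x, ∫ y, ∫ z, f x y * f y z * f z x ∂G ∂G ∂G := by
  have h := integrable_triangle (G := G) hf hb
  rw [integral_prod _ h, integral_prod _ h.integral_prod_left]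
  simp only [fun x z => hsymm z x]

/-- The expected number of triangles is `n choose 3` times the triangle density. -/
theorem expectedTriangles_eq (hf : Measurable (Function.uncurry f))
    (hb : ∃ C : ℝ, ∀ x y, |f x y| ≤ C) (hsymm : ∀ x y, f x y = f y x) (n : ℕ) :
    expectedTriangles G f n =
      n.choose 3 * ∫ x, ∫ y, ∫ z, f x y * f y z * f z x ∂G ∂G ∂G := by
  classical
  have hterm : ∀ s ∈ (Finset.univ : Finset (Fin n)).powersetCard 3,
      Integrable (fun x : Fin n → α => ∑ H : SimpleGraph (Fin n),
        graphProb f x H * (if H.IsNClique 3 s then 1 else 0)) (Measure.pi fun _ => G) ∧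
      ∫ x : Fin n → α, ∑ H : SimpleGraph (Fin n),
        graphProb f x H * (if H.IsNClique 3 s then 1 else 0) ∂(Measure.pi fun _ => G) =
      ∫ x, ∫ y, ∫ z, f x y * f y z * f z x ∂G ∂G ∂G := by
    intro s hs
    obtain ⟨a, b, c, hab, hbc, rfl⟩ :=
      Finset.exists_lt_lt_of_card_eq_three (Finset.mem_powersetCard.1 hs).2
    have hp := measurePreserving_eval_triple G hab.ne (hab.trans hbc).ne hbc.ne
    have hint := integrable_triangle (G := G) hf hb
    simp only [sum_graphProb_mul_isNClique f _ hab hbc]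
    refine ⟨hp.integrable_comp_of_integrable hint, ?_⟩
    rw [← integral_triangle hf hb hsymm]
    exact hp.integral_comp_of_aestronglyMeasurable hint.1
  have hswap : ∀ x : Fin n → α, ∑ H : SimpleGraph (Fin n),
      graphProb f x H * ((H.cliqueSet 3).ncard : ℝ) =
      ∑ s ∈ (Finset.univ : Finset (Fin n)).powersetCard 3, ∑ H : SimpleGraph (Fin n),
        graphProb f x H * (if H.IsNClique 3 s then 1 else 0) := fun x => by
    rw [Finset.sum_comm]
    refine Finset.sum_congr rfl fun H _ => ?_
    rw [SimpleGraph.ncard_cliqueSet_eq_sum, Finset.mul_sum]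
    congr!
  rw [expectedTriangles]
  simp only [hswap]
  rw [integral_finsetSum _ fun s hs => (hterm s hs).1,
    Finset.sum_congr rfl fun s hs => (hterm s hs).2]
  simp

end Triangles

/-! ### Assembly of the results. -/

theorem lemma4 {d : ℕ} (Z : Set (EuclideanSpace ℝ (Fin d)))
    (G : Measure Z) [IsProbabilityMeasure G] (f : Z → Z → ℝ)
    (hsymm : ∀ x y, f x y = f y x)
    (hbdd : ∃ C : ℝ, ∀ x y, |f x y| ≤ C)
    (hlip : LipschitzInEachVariable f) :
    (∃ lam : ℕ → ℝ, IsEigenvalueSequence (integralOperator G f hlip.measurable hbdd) lam) ∧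
    ∀ lam : ℕ → ℝ, IsEigenvalueSequence (integralOperator G f hlip.measurable hbdd) lam →
      (IsPosDefKernel f → ∀ k, 0 ≤ lam k) ∧
      HasSum (fun k => lam k ^ 3) (∫ x, ∫ y, ∫ z, f x y * f y z * f z x ∂G ∂G ∂G) ∧
      ((∀ x y, f x y ∈ Set.Icc (0 : ℝ) 1) → ∀ n : ℕ,
        expectedTriangles G f n = (n.choose 3 : ℝ) * ∑' k, lam k ^ 3 ∧
        ∀ S : Set ℕ, (∀ k ∈ S, lam k < 0) →
          expectedTriangles G f n ≤ (n.choose 3 : ℝ) * ∑' k : (Sᶜ : Set ℕ), lam k ^ 3) := by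

  refine ⟨exists_isEigenvalueSequence (isCompactOperator_integralOperator _ _)
    (integralOperator_isSymmetric _ _ hsymm)
    fun _ _ hb => summable_norm_integralOperator_sq _ _ hb, fun lam hlam => ?_⟩
  have hsum := hlam.hasSum_pow_three _ _ hsymm
  refine ⟨fun hpd => hpd.eigenvalue_nonneg _ _ hlam, hsum, fun _ n => ?_⟩
  have hT : expectedTriangles G f n = (n.choose 3 : ℝ) * ∑' k, lam k ^ 3 := by
    rw [expectedTriangles_eq hlip.measurable hbdd hsymm, hsum.tsum_eq]
  refine ⟨hT, fun S hS => ?_⟩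
  -- Splitting off `S` leaves a sum of negative cubes, which can be dropped.
  rw [hT, ← (hsum.summable.subtype S).tsum_add_tsum_compl (hsum.summable.subtype Sᶜ)]
  gcongr
  refine add_le_of_nonpos_left (tsum_nonpos fun k => ?_)
  exact (Odd.pow_neg (by decide) (hS k k.2)).le
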